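/- **Theorem 4.5 (Theorem D).** Rings are associative with unit, and modules are left modules unless stated otherwise. Let $\Lambda$ and $\Gamma$ be left and right noetherian rings that are symmetrically separably equivalent, that is: there are bimodules ${}_\Lambda M_\Gamma$ and ${}_\Gamma N_\Lambda$, each finitely generated and projective both as a left module and as a right module, and bimodules ${}_\Lambda X_\Lambda$ and ${}_\Gamma Y_\Gamma$, such that $M\otimes_\Gamma N\cong \Lambda\oplus X$ as $\Lambda$-$\Lambda$-bimodules and $N\otimes_\Lambda M\cong \Gamma\oplus Y$ as $\Gamma$-$\Gamma$-bimodules, and such that $(M\otimes_\Gamma-,\,N\otimes_\Lambda-)$ and $(N\otimes_\Lambda-,\,M\otimes_\Gamma-)$ are adjoint pairs of functors between $\mathrm{Mod}\,\Gamma$ and $\mathrm{Mod}\,\Lambda$. For integers $n,k$, a ring $R$ is said to be $G_n(k)$ if the minimal injective resolution $0\to {}_RR\to I^0\to I^1\to\cdots$ of the left module ${}_RR$ satisfies $\mathrm{fd}_R\, I^i\le k+i$ for all $0\le i\le n-1$, where $\mathrm{fd}_R$ is the flat dimension and $\mathrm{fd}_R\,0=-\infty$. Then, for all integers $n$ and $k$,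 $\Lambda$ is $G_n(k)$ if and only if $\Gamma$ is $G_n(k)$. -/

import Mathlib

open CategoryTheory MulOpposite
open scoped TensorProduct

universe u

/-! ### Tensor products over a noncommutative ring

Right `R`-modules are modules over `Rᵐᵒᵖ`, and an `S`-`R`-bimodule is an abelian group with
commuting actions of `S` (left) and `Rᵐᵒᵖ` (right). -/

/-- The relations `(a r) ⊗ b = a ⊗ (r b)` of the tensor product of a right and a left module. -/
def balancedRel (R A B : Type*) [Ring R] [AddCommGroup A] [Module Rᵐᵒᵖ A]
    [AddCommGroup B] [Module R B] : Submodule ℤ (A ⊗[ℤ] B) :=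
  Submodule.span ℤ {t | ∃ (a : A) (r : R) (b : B), t = (op r • a) ⊗ₜ[ℤ] b - a ⊗ₜ[ℤ] (r • b)}

/-- The tensor product `A ⊗_R B` of a right `R`-module `A` and a left `R`-module `B`. -/
def BalancedTensor (R A B : Type*) [Ring R] [AddCommGroup A] [Module Rᵐᵒᵖ A]
    [AddCommGroup B] [Module R B] : Type _ :=
  (A ⊗[ℤ] B) ⧸ balancedRel R A B

namespace BalancedTensor

section

variable (R : Type*) {A A' A'' B B' B'' : Type*} [Ring R]
  [AddCommGroup A] [Module Rᵐᵒᵖ A] [AddCommGroup A'] [Module Rᵐᵒᵖ A']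
  [AddCommGroup A''] [Module Rᵐᵒᵖ A'']
  [AddCommGroup B] [Module R B] [AddCommGroup B'] [Module R B']
  [AddCommGroup B''] [Module R B'']

instance : AddCommGroup (BalancedTensor R A B) :=
  inferInstanceAs (AddCommGroup ((A ⊗[ℤ] B) ⧸ balancedRel R A B))

/-- The class `a ⊗ b` in `A ⊗_R B`. -/
def tmul (a : A) (b : B) : BalancedTensor R A B :=
  Submodule.Quotient.mk (p := balancedRel R A B) (a ⊗ₜ[ℤ] b)

/-- The map `f ⊗ g` induced by linear maps `f : A → A'` and `g : B → B'`. -/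
def map (f : A →ₗ[Rᵐᵒᵖ] A') (g : B →ₗ[R] B') :
    BalancedTensor R A B →+ BalancedTensor R A' B' :=
  ((balancedRel R A B).mapQ (balancedRel R A' B')
    (TensorProduct.map f.toAddMonoidHom.toIntLinearMap g.toAddMonoidHom.toIntLinearMap) (by
      refine Submodule.span_le.2 ?_
      rintro _ ⟨a, r, b, rfl⟩
      refine Submodule.subset_span ⟨f a, r, g b, ?_⟩
      change TensorProduct.map _ _ (_ - _) = _
      rw [map_sub, TensorProduct.map_tmul, TensorProduct.map_tmul]
      simp)).toAddMonoidHom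

@[simp] theorem map_tmul (f : A →ₗ[Rᵐᵒᵖ] A') (g : B →ₗ[R] B') (a : A) (b : B) :
    map R f g (tmul R a b) = tmul R (f a) (g b) := rfl

variable {R} in
@[elab_as_elim] theorem induction_on {p : BalancedTensor R A B → Prop}
    (t : BalancedTensor R A B) (zero : p 0) (tmul : ∀ a b, p (tmul R a b))
    (add : ∀ x y, p x → p y → p (x + y)) : p t := by
  obtain ⟨t, rfl⟩ := Submodule.Quotient.mk_surjective (balancedRel R A B) t
  induction t using TensorProduct.induction_on with
  | zero => exact zero
  | tmul a b => exact tmul a b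
  | add x y hx hy => exact add _ _ hx hy

theorem smul_tmul (a : A) (r : R) (b : B) : tmul R (op r • a) b = tmul R a (r • b) :=
  (Submodule.Quotient.eq _).2 (Submodule.subset_span ⟨a, r, b, rfl⟩)

theorem add_tmul (a a' : A) (b : B) : tmul R (a + a') b = tmul R a b + tmul R a' b :=
  congrArg (Submodule.Quotient.mk (p := balancedRel R A B)) (TensorProduct.add_tmul a a' b)

theorem tmul_add (a : A) (b b' : B) : tmul R a (b + b') = tmul R a b + tmul R a b' :=
  congrArg (Submodule.Quotient.mk (p := balancedRel R A B)) (TensorProduct.tmul_add a b b')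

theorem zero_tmul (b : B) : tmul R (0 : A) b = 0 :=
  congrArg (Submodule.Quotient.mk (p := balancedRel R A B)) (TensorProduct.zero_tmul A b)

theorem tmul_zero (a : A) : tmul R a (0 : B) = 0 :=
  congrArg (Submodule.Quotient.mk (p := balancedRel R A B)) (TensorProduct.tmul_zero B a)

/-- `A ⊗_R B` is a left `S`-module when `A` is an `S`-`R`-bimodule: `s (a ⊗ b) = (s a) ⊗ b`. -/
instance leftModule {S : Type*} [Ring S] [Module S A] [SMulCommClass S Rᵐᵒᵖ A] :
    Module S (BalancedTensor R A B) where
  smul s := map R (Module.toModuleEnd Rᵐᵒᵖ (S := S) A s) LinearMap.id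
  one_smul t := by
    change map R _ _ t = t
    induction t using induction_on <;> simp_all
  mul_smul s s' t := by
    change map R _ _ t = map R _ _ (map R _ _ t)
    induction t using induction_on <;> simp_all [mul_smul]
  smul_zero s := map_zero _
  smul_add s := map_add _
  add_smul s s' t := by
    change map R _ _ t = map R _ _ t + map R _ _ t
    induction t using induction_on with
    | zero => simp
    | tmul a b => simp [add_smul, add_tmul]
    | add x y hx hy =>
      rw [AddMonoidHom.map_add, AddMonoidHom.map_add, AddMonoidHom.map_add, hx, hy]; abel
  zero_smul t := by
    change map R _ _ t = 0
    induction t using induction_on <;> simp_all [zero_tmul]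

/-- `A ⊗_R B` is a right `T`-module when `B` is an `R`-`T`-bimodule: `(a ⊗ b) t = a ⊗ (b t)`. -/
instance rightModule {T : Type*} [Ring T] [Module Tᵐᵒᵖ B] [SMulCommClass R Tᵐᵒᵖ B] :
    Module Tᵐᵒᵖ (BalancedTensor R A B) :=
  letI : SMulCommClass Tᵐᵒᵖ R B := SMulCommClass.symm _ _ _
  { smul := fun s => map R LinearMap.id (Module.toModuleEnd R (S := Tᵐᵒᵖ) B s)
    one_smul := fun t => by
      change map R _ _ t = t
      induction t using induction_on <;> simp_all
    mul_smul := fun s s' t => by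
      change map R _ _ t = map R _ _ (map R _ _ t)
      induction t using induction_on <;> simp_all [mul_smul]
    smul_zero := fun s => map_zero _
    smul_add := fun s => map_add _
    add_smul := fun s s' t => by
      change map R _ _ t = map R _ _ t + map R _ _ t
      induction t using induction_on with
      | zero => simp
      | tmul a b => simp [add_smul, tmul_add]
      | add x y hx hy =>
        rw [AddMonoidHom.map_add, AddMonoidHom.map_add, AddMonoidHom.map_add, hx, hy]; abel
    zero_smul := fun t => by
      change map R _ _ t = 0
      induction t using induction_on <;> simp_all [tmul_zero] }

theorem left_smul_tmul {S : Type*} [Ring S] [Module S A] [SMulCommClass S Rᵐᵒᵖ A]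
    (s : S) (a : A) (b : B) : s • tmul R a b = tmul R (s • a) b := rfl

theorem right_smul_tmul {T : Type*} [Ring T] [Module Tᵐᵒᵖ B] [SMulCommClass R Tᵐᵒᵖ B]
    (t : T) (a : A) (b : B) : op t • tmul R a b = tmul R a (op t • b) := rfl

/-- For an `S`-`R`-bimodule `A`, the map `A ⊗_R g` is `S`-linear. -/
def lTensor (S : Type*) [Ring S] [Module S A] [SMulCommClass S Rᵐᵒᵖ A] (g : B →ₗ[R] B') :
    BalancedTensor R A B →ₗ[S] BalancedTensor R A B' :=
  { map R LinearMap.id g with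
    map_smul' := fun s t => by
      change map R _ g (s • t) = s • map R _ g t
      induction t using induction_on with
      | zero => simp
      | tmul a b => simp [left_smul_tmul]
      | add x y hx hy => simp only [smul_add, _root_.map_add, hx, hy] }

end

/-- The functor `P ⊗_R - : Mod R ⥤ Mod S` of an `S`-`R`-bimodule `P`. -/
def functor (S R P : Type u) [Ring S] [Ring R] [AddCommGroup P] [Module S P] [Module Rᵐᵒᵖ P]
    [SMulCommClass S Rᵐᵒᵖ P] : ModuleCat.{u} R ⥤ ModuleCat.{u} S where
  obj B := ModuleCat.of S (BalancedTensor R P B)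
  map g := ModuleCat.ofHom (lTensor R S g.hom)
  map_id B := by
    ext t
    change map R _ _ t = t
    induction t using induction_on <;> simp_all
  map_comp g h := by
    ext t
    change map R _ _ t = map R _ _ (map R _ _ t)
    induction t using induction_on <;> simp_all

end BalancedTensor

/-! ### Symmetric separable equivalence -/

/-- The bimodules `M` (a `Λ`-`Γ`-bimodule) and `N` (a `Γ`-`Λ`-bimodule) define a symmetric
separable equivalence between `Λ` and `Γ`. -/
structure IsSymmSepEquiv (Λ Γ M N : Type u) [Ring Λ] [Ring Γ]
    [AddCommGroup M] [Module Λ M] [Module Γᵐᵒᵖ M] [SMulCommClass Λ Γᵐᵒᵖ M]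
    [AddCommGroup N] [Module Γ N] [Module Λᵐᵒᵖ N] [SMulCommClass Γ Λᵐᵒᵖ N] : Prop where
  finite_left_M : Module.Finite Λ M
  projective_left_M : Module.Projective Λ M
  finite_right_M : Module.Finite Γᵐᵒᵖ M
  projective_right_M : Module.Projective Γᵐᵒᵖ M
  finite_left_N : Module.Finite Γ N
  projective_left_N : Module.Projective Γ N
  finite_right_N : Module.Finite Λᵐᵒᵖ N
  projective_right_N : Module.Projective Λᵐᵒᵖ N
  /-- `M ⊗_Γ N ≅ Λ ⊕ X` as `Λ`-bimodules, for some `Λ`-bimodule `X`. -/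
  exists_iso_left : ∃ (X : Type u) (_ : AddCommGroup X) (_ : Module Λ X) (_ : Module Λᵐᵒᵖ X)
    (_ : SMulCommClass Λ Λᵐᵒᵖ X) (e : BalancedTensor Γ M N ≃+ Λ × X),
    (∀ (a : Λ) t, e (a • t) = a • e t) ∧ ∀ (a : Λ) t, e (op a • t) = op a • e t
  /-- `N ⊗_Λ M ≅ Γ ⊕ Y` as `Γ`-bimodules, for some `Γ`-bimodule `Y`. -/
  exists_iso_right : ∃ (Y : Type u) (_ : AddCommGroup Y) (_ : Module Γ Y) (_ : Module Γᵐᵒᵖ Y)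
    (_ : SMulCommClass Γ Γᵐᵒᵖ Y) (e : BalancedTensor Λ N M ≃+ Γ × Y),
    (∀ (c : Γ) t, e (c • t) = c • e t) ∧ ∀ (c : Γ) t, e (op c • t) = op c • e t
  /-- `(M ⊗_Γ -, N ⊗_Λ -)` is an adjoint pair. -/
  adj_MN : Nonempty (BalancedTensor.functor Λ Γ M ⊣ BalancedTensor.functor Γ Λ N)
  /-- `(N ⊗_Λ -, M ⊗_Γ -)` is an adjoint pair. -/
  adj_NM : Nonempty (BalancedTensor.functor Γ Λ N ⊣ BalancedTensor.functor Λ Γ M)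

/-- The rings `Λ` and `Γ` are symmetrically separably equivalent. -/
def SymmSepEquivalent (Λ Γ : Type u) [Ring Λ] [Ring Γ] : Prop :=
  ∃ (M : Type u) (_ : AddCommGroup M) (_ : Module Λ M) (_ : Module Γᵐᵒᵖ M)
    (_ : SMulCommClass Λ Γᵐᵒᵖ M)
    (N : Type u) (_ : AddCommGroup N) (_ : Module Γ N) (_ : Module Λᵐᵒᵖ N)
    (_ : SMulCommClass Γ Λᵐᵒᵖ N), IsSymmSepEquiv Λ Γ M N

/-! ### Flat dimension -/

/-- A left `R`-module `F` is flat if `- ⊗_R F` preserves injectivity of maps of right modules. -/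
def IsFlatModule (R : Type u) [Ring R] (F : Type u) [AddCommGroup F] [Module R F] : Prop :=
  ∀ (A A' : Type u) [AddCommGroup A] [AddCommGroup A'] [Module Rᵐᵒᵖ A] [Module Rᵐᵒᵖ A']
    (f : A →ₗ[Rᵐᵒᵖ] A'), Function.Injective f →
      Function.Injective (BalancedTensor.map R f (LinearMap.id : F →ₗ[R] F))

/-- There is an exact sequence `0 → F_{m-1} → ⋯ → F_0 → E → 0` with all `F_j` flat
(for `m = 0`: the module `E` is zero). -/
def HasFlatResolution (R : Type u) [Ring R] :
    ℕ → ∀ (E : Type u) [AddCommGroup E] [Module R E], Prop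
  | 0, E, _, _ => Subsingleton E
  | m + 1, E, _, _ => ∃ (F : Type u) (_ : AddCommGroup F) (_ : Module R F) (f : F →ₗ[R] E),
      IsFlatModule R F ∧ Function.Surjective f ∧ HasFlatResolution R m (LinearMap.ker f)

/-- `fd_R E ≤ d`. For `d < 0` this means that `E` is the zero module, whose flat dimension
is `-∞`. -/
def FlatDimLE (R : Type u) [Ring R] (E : Type u) [AddCommGroup E] [Module R E] (d : ℤ) : Prop :=
  HasFlatResolution R (d + 1).toNat E

/-! ### The Auslander-type condition -/

/-- An injective resolution `0 → E → I⁰ → I¹ → ⋯` is minimal if, for every `i`, the kernel of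
`Iⁱ → Iⁱ⁺¹` is an essential submodule of `Iⁱ`. By exactness, this kernel is `E` for `i = 0` and
the image of `Iⁱ⁻¹` for `i > 0`, so this says that each `Iⁱ` is an injective envelope. -/
def IsMinimalResolution {R : Type u} [Ring R] {E : ModuleCat.{u} R}
    (I : InjectiveResolution E) : Prop :=
  ∀ (i : ℕ) (S : Submodule R (I.cocomplex.X i)),
    S ⊓ LinearMap.ker (I.cocomplex.d i (i + 1)).hom = ⊥ → S = ⊥

/-- The condition `G_n(k)`: the terms of the minimal injective resolution
`0 → Λ → I⁰ → I¹ → ⋯` of the left module `Λ` (it exists and is unique up to isomorphism) satisfy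
`fd Iⁱ ≤ k + i` for `0 ≤ i ≤ n - 1`. -/
def AuslanderTypeCondition (n k : ℤ) (Λ : Type u) [Ring Λ] : Prop :=
  ∃ I : InjectiveResolution (ModuleCat.of Λ Λ), IsMinimalResolution I ∧
    ∀ i : ℕ, (i : ℤ) ≤ n - 1 → FlatDimLE Λ (I.cocomplex.X i) (k + i)

/-!
A symmetric separable equivalence transfers injective coresolutions together with bounds on the
flat dimensions of their terms.

The functor `N ⊗_Λ -` is left and right adjoint to `M ⊗_Γ -`, so both functors are exact and
preserve injectives. As `N` is projective, hence flat, as a left `Γ`-module, `N ⊗_Λ -` also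
preserves flat modules (`IsFlatModule.balancedTensor`) and so does not increase flat dimensions.
Apply it to a coresolution of `M`, which exists with the same bounds as for `Λ` because `M` is a
summand of some `Λᵐ`. The result is a coresolution of `N ⊗_Λ M`, of which `Γ` is a summand; passing
to this summand (`IsSymmSepEquiv.hasFlatBoundedCoresolution`) gives the bounds for `Γ`. The
hypotheses being symmetric in `Λ` and `Γ`, one implication suffices.

Passing to summands needs two facts.

* The flat dimension of a summand is bounded by that of the module
  (`FlatDimLE.of_retract`). A module is flat if and only if its character module `Hom_ℤ(-, ℚ/ℤ)`
  is injective (`isFlatModule_iff_injective_rightDual`), so the flat dimension of a module is the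
  injective dimension of its character module (`hasFlatResolution_iff`), which is controlled by
  `Ext`.
* If `E` is a summand of `X`, the minimal injective resolution of `E` is a summand of every
  injective resolution of `X`, degree by degree (`HasFlatBoundedCoresolution.succ_of_retract`).
  This is because an endomorphism of an injective envelope of `E` that fixes `E` is an automorphism
  (`exists_retract_of_essential`). Injective envelopes are constructed as maximal essential
  extensions inside an injective module (`exists_injective_essential_extension`), and the minimal
  resolution by iterating them (`minimalResolution`).

In particular the condition `G_n(k)` says that some injective coresolution, minimal or not,
satisfies the bounds (`auslanderTypeCondition_iff`).
-/

/-! ### Characters of tensor products -/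

namespace BalancedTensor

variable {R A B C : Type*} [Ring R] [AddCommGroup A] [Module Rᵐᵒᵖ A]
  [AddCommGroup B] [Module R B] [AddCommGroup C]

/-- The additive map out of `A ⊗_R B` induced by a biadditive `R`-balanced map. -/
def lift (f : A →+ B →+ C) (hf : ∀ (a : A) (r : R) (b : B), f (op r • a) b = f a (r • b)) :
    BalancedTensor R A B →+ C :=
  ((balancedRel R A B).liftQ
    (AddMonoidHom.toIntLinearMap <| TensorProduct.liftAddHom f fun n a b => by simp) (by
      refine Submodule.span_le.2 ?_
      rintro _ ⟨a, r, b, rfl⟩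
      rw [SetLike.mem_coe, LinearMap.mem_ker, map_sub]
      change f _ _ - f _ _ = 0
      rw [hf, sub_self])).toAddMonoidHom

theorem hom_ext {f g : BalancedTensor R A B →+ C}
    (h : ∀ a b, f (tmul R a b) = g (tmul R a b)) : f = g := by
  ext t
  induction t using induction_on with
  | zero => simp
  | tmul a b => exact h a b
  | add x y hx hy => rw [map_add, map_add, hx, hy]

end BalancedTensor

/-- The character module `Hom_ℤ(F, ℚ/ℤ)` of a left `R`-module `F`, as a right `R`-module. -/
def RightDual (R F : Type*) [Ring R] [AddCommGroup F] [Module R F] : Type _ :=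
  F →+ AddCircle (1 : ℚ)

namespace RightDual

variable {R F F' : Type*} [Ring R] [AddCommGroup F] [Module R F] [AddCommGroup F'] [Module R F']

instance : AddCommGroup (RightDual R F) :=
  inferInstanceAs (AddCommGroup (F →+ AddCircle (1 : ℚ)))

instance : FunLike (RightDual R F) F (AddCircle (1 : ℚ)) :=
  inferInstanceAs (FunLike (F →+ AddCircle (1 : ℚ)) _ _)

instance : AddMonoidHomClass (RightDual R F) F (AddCircle (1 : ℚ)) :=
  inferInstanceAs (AddMonoidHomClass (F →+ AddCircle (1 : ℚ)) _ _)

@[ext] theorem ext {φ ψ : RightDual R F} (h : ∀ x, φ x = ψ x) : φ = ψ := DFunLike.ext _ _ h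

instance : Module Rᵐᵒᵖ (RightDual R F) where
  smul r φ := AddMonoidHom.comp φ (DistribSMul.toAddMonoidHom F r.unop)
  one_smul φ := ext fun x => congrArg φ (one_smul R x)
  mul_smul r s φ := ext fun x => congrArg φ (mul_smul s.unop r.unop x)
  smul_zero _ := rfl
  smul_add _ _ _ := rfl
  add_smul r s φ := ext fun x =>
    (congrArg φ (add_smul r.unop s.unop x)).trans (map_add φ _ _)
  zero_smul φ := ext fun x => (congrArg φ (zero_smul R x)).trans (map_zero φ)

@[simp] theorem add_apply (φ ψ : RightDual R F) (x : F) : (φ + ψ) x = φ x + ψ x := rfl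
@[simp] theorem zero_apply (x : F) : (0 : RightDual R F) x = 0 := rfl

/-- Precomposition with a linear map. -/
def dual (f : F →ₗ[R] F') : RightDual R F' →ₗ[Rᵐᵒᵖ] RightDual R F where
  toFun φ := AddMonoidHom.comp φ f.toAddMonoidHom
  map_add' _ _ := rfl
  map_smul' r φ := ext fun x => congrArg φ (f.map_smul r.unop x).symm

@[simp] theorem dual_apply (f : F →ₗ[R] F') (φ : RightDual R F') (x : F) :
    dual f φ x = φ (f x) := rfl

end RightDual

/-- `ℚ/ℤ` is an injective abelian group. -/
theorem exists_character_extension {A A' : Type*} [AddCommGroup A] [AddCommGroup A']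
    (f : A →+ A') (hf : Function.Injective f) (c : A →+ AddCircle (1 : ℚ)) :
    ∃ c' : A' →+ AddCircle (1 : ℚ), ∀ a, c' (f a) = c a := by
  obtain ⟨c', h⟩ := (Module.Baer.of_divisible (AddCircle (1 : ℚ))).extension_property_addMonoidHom
    f hf c
  exact ⟨c', fun a => DFunLike.congr_fun h a⟩

theorem exists_character_ne_zero {A : Type*} [AddCommGroup A] {a : A} (ha : a ≠ 0) :
    ∃ c : A →+ AddCircle (1 : ℚ), c a ≠ 0 :=
  CharacterModule.exists_character_apply_ne_zero_of_ne_zero ha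

namespace RightDual

variable {R F F' F'' : Type*} [Ring R] [AddCommGroup F] [Module R F] [AddCommGroup F']
  [Module R F'] [AddCommGroup F''] [Module R F'']

theorem dual_injective {f : F →ₗ[R] F'} (hf : Function.Surjective f) :
    Function.Injective (dual f) := fun φ ψ h => ext fun y => by
  obtain ⟨x, rfl⟩ := hf y
  exact DFunLike.congr_fun h x

theorem dual_surjective {f : F →ₗ[R] F'} (hf : Function.Injective f) :
    Function.Surjective (dual f) := fun φ => by
  obtain ⟨c, hc⟩ := exists_character_extension f.toAddMonoidHom hf φ
  exact ⟨c, ext hc⟩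

theorem dual_exact {f : F →ₗ[R] F'} {g : F' →ₗ[R] F''} (h : Function.Exact f g)
    (hg : Function.Surjective g) : Function.Exact (dual g) (dual f) := fun φ => by
  constructor
  · intro hφ
    have hker : ∀ x, g x = 0 → φ x = 0 := fun x hx => by
      obtain ⟨y, rfl⟩ := (h x).1 hx
      exact DFunLike.congr_fun hφ y
    let e := g.quotKerEquivOfSurjective hg
    let c : (F' ⧸ LinearMap.ker g) →+ AddCircle (1 : ℚ) :=
      QuotientAddGroup.lift (LinearMap.ker g).toAddSubgroup φ (fun x hx => hker x hx)
    refine ⟨c.comp e.symm.toLinearMap.toAddMonoidHom, ext fun x => ?_⟩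
    change c (e.symm (g x)) = φ x
    have : e.symm (g x) = Submodule.Quotient.mk x := by
      rw [LinearEquiv.symm_apply_eq]; rfl
    rw [this]; rfl
  · rintro ⟨ψ, rfl⟩
    ext x
    simp [h.apply_apply_eq_zero]

theorem subsingleton_iff : Subsingleton (RightDual R F) ↔ Subsingleton F := by
  constructor
  · intro h
    refine ⟨fun x y => ?_⟩
    by_contra hxy
    obtain ⟨c, hc⟩ := exists_character_ne_zero (sub_ne_zero.2 hxy)
    exact hc (DFunLike.congr_fun (Subsingleton.elim (α := RightDual R F) c 0) (x - y))
  · intro h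
    exact ⟨fun φ ψ => ext fun x => by rw [Subsingleton.elim x 0, map_zero, map_zero]⟩

end RightDual

/-! ### Flat modules -/

section Flat

variable {R : Type u} [Ring R] {F F' : Type u} [AddCommGroup F] [Module R F]
  [AddCommGroup F'] [Module R F']

/-- The adjunction `Hom_ℤ(A ⊗_R F, ℚ/ℤ) ≅ Hom_R(A, Hom_ℤ(F, ℚ/ℤ))`, in one direction. -/
def RightDual.curry {A : Type*} [AddCommGroup A] [Module Rᵐᵒᵖ A]
    (c : BalancedTensor R A F →+ AddCircle (1 : ℚ)) : A →ₗ[Rᵐᵒᵖ] RightDual R F where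
  toFun a := c.comp
    { toFun := fun b => BalancedTensor.tmul R a b
      map_zero' := BalancedTensor.tmul_zero R a
      map_add' := BalancedTensor.tmul_add R a }
  map_add' a a' := RightDual.ext fun b =>
    (congrArg c (BalancedTensor.add_tmul R a a' b)).trans (map_add c _ _)
  map_smul' r a := RightDual.ext fun b => congrArg c (BalancedTensor.smul_tmul R a r.unop b)

/-- The adjunction `Hom_R(A, Hom_ℤ(F, ℚ/ℤ)) ≅ Hom_ℤ(A ⊗_R F, ℚ/ℤ)`, in one direction. -/
def RightDual.uncurry {A : Type*} [AddCommGroup A] [Module Rᵐᵒᵖ A]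
    (f : A →ₗ[Rᵐᵒᵖ] RightDual R F) : BalancedTensor R A F →+ AddCircle (1 : ℚ) :=
  BalancedTensor.lift (f.toAddMonoidHom : A →+ (F →+ AddCircle (1 : ℚ)))
    fun a r b => DFunLike.congr_fun (f.map_smul (op r) a) b

/-- Lambek's criterion: by the adjunction, extending maps into the character module of `F` means
extending characters of `A ⊗_R F`. -/
theorem isFlatModule_iff_injective_rightDual :
    IsFlatModule R F ↔ Module.Injective Rᵐᵒᵖ (RightDual R F) := by
  constructor
  · intro hF
    refine ⟨fun A A' _ _ _ _ f hf g => ?_⟩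
    obtain ⟨c, hc⟩ := exists_character_extension _ (hF A A' f hf) (RightDual.uncurry g)
    exact ⟨RightDual.curry c, fun a => RightDual.ext fun b => hc (BalancedTensor.tmul R a b)⟩
  · intro hF A A' _ _ _ _ f hf
    rw [injective_iff_map_eq_zero]
    intro t ht
    by_contra h0
    obtain ⟨c, hc⟩ := exists_character_ne_zero h0
    obtain ⟨h, hh⟩ := hF.out f hf (RightDual.curry c)
    refine hc ?_
    have : (RightDual.uncurry h).comp (BalancedTensor.map R f LinearMap.id) = c :=
      BalancedTensor.hom_ext fun a b => DFunLike.congr_fun (hh a) b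
    rw [← this, AddMonoidHom.comp_apply, ht, map_zero]

/-- For `F` projective and `A → A'` injective, a map `g : A → Hom_ℤ(F, ℚ/ℤ)` is extended to `A'`
on the generators of the free module on the set `F`, of which `F` is a retract. -/
theorem IsFlatModule.of_projective [Module.Projective R F] : IsFlatModule R F := by
  rw [isFlatModule_iff_injective_rightDual]
  obtain ⟨s, hs⟩ := Module.projective_lifting_property
    (Finsupp.linearCombination R (id : F → F)) LinearMap.id
    (Finsupp.linearCombination_id_surjective R F)
  refine ⟨fun A A' _ _ _ _ f hf g => ?_⟩
  have key : ∀ x : F, ∃ c : A' →+ AddCircle (1 : ℚ), ∀ a, c (f a) = g a x := fun x =>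
    exists_character_extension f.toAddMonoidHom hf
      { toFun := fun a => g a x, map_zero' := by simp, map_add' := by simp }
  choose c hc using key
  let c' (a : A') : (F →₀ R) →+ AddCircle (1 : ℚ) := Finsupp.liftAddHom fun x =>
    { toFun := fun r => c x (op r • a)
      map_zero' := by simp
      map_add' := by simp [add_smul] }
  have hc' (a : A') (x : F) (r : R) : c' a (Finsupp.single x r) = c x (op r • a) := by simp [c']
  let h : A' →ₗ[Rᵐᵒᵖ] RightDual R (F →₀ R) :=
    { toFun := c'
      map_add' := fun a a' => Finsupp.addHom_ext (f := c' (a + a')) (g := c' a + c' a')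
        fun x r => by simp only [AddMonoidHom.add_apply, hc', smul_add, map_add]
      map_smul' := fun r a => by
        obtain ⟨r, rfl⟩ := op_surjective r
        refine Finsupp.addHom_ext (f := c' (op r • a))
          (g := (c' a).comp (DistribSMul.toAddMonoidHom (F →₀ R) r)) fun x s => ?_
        change c' (op r • a) _ = c' a (r • _)
        rw [Finsupp.smul_single, hc', hc', smul_eq_mul, op_mul, mul_smul] }
  have hfg : ∀ a v, h (f a) v = g a (Finsupp.linearCombination R (id : F → F) v) := by
    intro a v
    change c' (f a) v = _
    induction v using Finsupp.induction_linear with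
    | zero => simp
    | add v w hv hw => simp only [map_add, hv, hw]
    | single x r =>
      rw [hc', ← map_smul, hc, map_smul, Finsupp.linearCombination_single]; rfl
  refine ⟨(RightDual.dual s).comp h, fun a => RightDual.ext fun x => ?_⟩
  change h (f a) (s x) = g a x
  rw [hfg]
  exact congrArg (g a) (LinearMap.congr_fun hs x)

/-- An element of `A ⊗_R Fᵐ` is determined by its components in `A ⊗_R F`. -/
theorem IsFlatModule.pi_const (hF : IsFlatModule R F) (m : ℕ) : IsFlatModule R (Fin m → F) := by
  intro A A' _ _ _ _ f hf
  rw [injective_iff_map_eq_zero]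
  intro t ht
  have hproj : ∀ j, BalancedTensor.map R LinearMap.id
      (LinearMap.proj j : (Fin m → F) →ₗ[R] F) t = 0 := fun j => by
    refine (injective_iff_map_eq_zero _).1 (hF A A' f hf) _ ?_
    have : (BalancedTensor.map R f LinearMap.id).comp (BalancedTensor.map R LinearMap.id
        (LinearMap.proj j : (Fin m → F) →ₗ[R] F)) = (BalancedTensor.map R LinearMap.id
        (LinearMap.proj j)).comp (BalancedTensor.map R f LinearMap.id) :=
      BalancedTensor.hom_ext fun a b => rfl
    rw [← AddMonoidHom.comp_apply, this, AddMonoidHom.comp_apply, ht, map_zero]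
  -- The identity of `A ⊗ Fᵐ` is the sum of the maps induced by `Fᵐ → F → Fᵐ`.
  have hsum : ∑ j, (BalancedTensor.map R LinearMap.id (LinearMap.single R (fun _ => F) j)).comp
      (BalancedTensor.map R LinearMap.id (LinearMap.proj j : (Fin m → F) →ₗ[R] F))
      = AddMonoidHom.id (BalancedTensor R A (Fin m → F)) := by
    refine BalancedTensor.hom_ext fun a b => ?_
    let T : (Fin m → F) →+ BalancedTensor R A (Fin m → F) :=
      { toFun := fun b => BalancedTensor.tmul R a b
        map_zero' := BalancedTensor.tmul_zero R a
        map_add' := BalancedTensor.tmul_add R a }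
    rw [AddMonoidHom.finsetSum_apply]
    change ∑ j, T (Pi.single j (b j)) = T b
    rw [← map_sum, Finset.univ_sum_single]
  have := DFunLike.congr_fun hsum t
  rw [AddMonoidHom.finsetSum_apply] at this
  simpa [hproj] using this.symm

end Flat

/-! ### Flat dimension -/

section FlatDim

variable {R : Type u} [Ring R] {E E' F K : Type u} [AddCommGroup E] [Module R E]
  [AddCommGroup E'] [Module R E'] [AddCommGroup F] [Module R F] [AddCommGroup K] [Module R K]

theorem shortExact_rightDual {i : K →ₗ[R] F} {p : F →ₗ[R] E} (hi : Function.Injective i)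
    (hip : Function.Exact i p) (hp : Function.Surjective p) :
    (ShortComplex.mk (X₁ := ModuleCat.of Rᵐᵒᵖ (RightDual R E))
      (X₂ := ModuleCat.of Rᵐᵒᵖ (RightDual R F)) (X₃ := ModuleCat.of Rᵐᵒᵖ (RightDual R K))
      (ModuleCat.ofHom (RightDual.dual p)) (ModuleCat.ofHom (RightDual.dual i))
      (by ext φ; exact (RightDual.dual_exact hip hp).apply_apply_eq_zero φ)).ShortExact :=
  ModuleCat.shortComplex_shortExact _ (RightDual.dual_exact hip hp)
    (RightDual.dual_injective hp) (RightDual.dual_surjective hi)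

theorem hasInjectiveDimensionLT_rightDual_of_isFlatModule (hF : IsFlatModule R F) (m : ℕ) :
    HasInjectiveDimensionLT (ModuleCat.of Rᵐᵒᵖ (RightDual R F)) (m + 1) := by
  have := (Module.injective_iff_injective_object _ _).1
    (isFlatModule_iff_injective_rightDual.1 hF)
  exact hasInjectiveDimensionLT_of_ge _ 1 _ (by omega)

/-- Flat resolutions of length `m` are detected by the injective dimension of the character
module. This makes the existence of such a resolution independent of the choice of syzygies. -/
theorem hasFlatResolution_iff (m : ℕ) : ∀ (E : Type u) [AddCommGroup E] [Module R E],
    HasFlatResolution R m E ↔ HasInjectiveDimensionLT (ModuleCat.of Rᵐᵒᵖ (RightDual R E)) m := by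
  induction m with
  | zero =>
    intro E _ _
    rw [hasInjectiveDimensionLT_zero_iff_isZero, ModuleCat.isZero_iff_subsingleton]
    exact (RightDual.subsingleton_iff (R := R) (F := E)).symm
  | succ m ih =>
    intro E _ _
    constructor
    · rintro ⟨F, _, _, f, hF, hf, hK⟩
      exact (shortExact_rightDual (LinearMap.ker f).injective_subtype
        (LinearMap.exact_subtype_ker_map f) hf).hasInjectiveDimensionLT_X₁ m ((ih _).1 hK)
        (hasInjectiveDimensionLT_rightDual_of_isFlatModule hF m)
    · intro h
      rcases m with _ | m
      · -- A module of flat dimension at most `0` is its own flat resolution.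
        have hE : Injective (ModuleCat.of Rᵐᵒᵖ (RightDual R E)) := inferInstance
        refine ⟨E, _, _, LinearMap.id, isFlatModule_iff_injective_rightDual.2
          ((Module.injective_iff_injective_object _ _).2 hE), Function.surjective_id, ?_⟩
        change Subsingleton _
        rw [LinearMap.ker_id]
        infer_instance
      · let p := Finsupp.linearCombination R (id : E → E)
        have hp : Function.Surjective p := Finsupp.linearCombination_id_surjective R E
        have hF : IsFlatModule R (E →₀ R) := .of_projective
        refine ⟨E →₀ R, _, _, p, hF, hp, (ih _).2 ?_⟩
        exact (shortExact_rightDual (LinearMap.ker p).injective_subtype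
          (LinearMap.exact_subtype_ker_map p) hp).hasInjectiveDimensionLT_X₃ _
          (hasInjectiveDimensionLT_rightDual_of_isFlatModule hF m) h

theorem FlatDimLE.of_retract {d : ℤ} (i : E →ₗ[R] E') (r : E' →ₗ[R] E)
    (hri : r ∘ₗ i = LinearMap.id) (h : FlatDimLE R E' d) : FlatDimLE R E d := by
  rw [FlatDimLE, hasFlatResolution_iff] at h ⊢
  refine Retract.hasInjectiveDimensionLT (Y := ModuleCat.of Rᵐᵒᵖ (RightDual R E'))
    { i := ModuleCat.ofHom (RightDual.dual r)
      r := ModuleCat.ofHom (RightDual.dual i)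
      retract := by
        ext φ
        exact RightDual.ext fun x => congrArg φ (LinearMap.congr_fun hri x) } _

/-- In `HasFlatResolution`, the kernel of the first map may be replaced by any module `K` that is
part of a short exact sequence `0 → K → F → E → 0`. -/
theorem HasFlatResolution.of_exact {m : ℕ} {i : K →ₗ[R] F} {p : F →ₗ[R] E}
    (hi : Function.Injective i) (hip : Function.Exact i p) (hp : Function.Surjective p)
    (hF : IsFlatModule R F) (hK : HasFlatResolution R m K) : HasFlatResolution R (m + 1) E := by
  rw [hasFlatResolution_iff] at hK ⊢
  exact (shortExact_rightDual hi hip hp).hasInjectiveDimensionLT_X₁ m hK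
    (hasInjectiveDimensionLT_rightDual_of_isFlatModule hF m)

theorem exact_compLeft {ι : Type*} {i : K →ₗ[R] F} {p : F →ₗ[R] E} (hip : Function.Exact i p) :
    Function.Exact (i.compLeft ι) (p.compLeft ι) := fun v => by
  constructor
  · intro h
    choose w hw using fun j => (hip (v j)).1 (congrFun h j)
    exact ⟨w, funext hw⟩
  · rintro ⟨w, rfl⟩
    exact funext fun j => hip.apply_apply_eq_zero (w j)

theorem HasFlatResolution.pi_const (k : ℕ) (m : ℕ) :
    ∀ (E : Type u) [AddCommGroup E] [Module R E],
      HasFlatResolution R m E → HasFlatResolution R m (Fin k → E) := by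
  induction m with
  | zero =>
    intro E _ _ h
    have : Subsingleton E := h
    change Subsingleton _
    infer_instance
  | succ m ih =>
    rintro E _ _ ⟨F, _, _, f, hF, hf, hK⟩
    exact .of_exact (i := (LinearMap.ker f).subtype.compLeft (Fin k)) (p := f.compLeft (Fin k))
      (LinearMap.ker f).injective_subtype.comp_left
      (exact_compLeft (LinearMap.exact_subtype_ker_map f)) hf.comp_left (hF.pi_const k) (ih _ hK)

end FlatDim

/-! ### Flatness and change of rings -/

section ChangeRings

variable {S R P : Type u} [Ring S] [Ring R] [AddCommGroup P] [Module S P] [Module Rᵐᵒᵖ P]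
  [SMulCommClass S Rᵐᵒᵖ P] {F : Type u} [AddCommGroup F] [Module R F]

/-- For `P` flat over `S` and `F` flat over `R`, a map `A → Hom_ℤ(P ⊗_R F, ℚ/ℤ)` is the same thing
as a map `A ⊗_S P → Hom_ℤ(F, ℚ/ℤ)`, which extends along `A ⊗_S P → A' ⊗_S P`. -/
theorem IsFlatModule.balancedTensor (hP : IsFlatModule S P) (hF : IsFlatModule R F) :
    IsFlatModule S (BalancedTensor R P F) := by
  rw [isFlatModule_iff_injective_rightDual] at hF ⊢
  refine ⟨fun A A' _ _ _ _ f hf g => ?_⟩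
  let tmulR (p : P) : F →+ BalancedTensor R P F :=
    { toFun := fun x => BalancedTensor.tmul R p x
      map_zero' := BalancedTensor.tmul_zero R p
      map_add' := BalancedTensor.tmul_add R p }
  -- `gl` is the transpose `A ⊗_S P → Hom_ℤ(F, ℚ/ℤ)` of `g`, first as an additive map.
  let gb : BalancedTensor S A P →+ RightDual R F := BalancedTensor.lift
    { toFun := fun a =>
        { toFun := fun p => (g a : BalancedTensor R P F →+ AddCircle (1 : ℚ)).comp (tmulR p)
          map_zero' := RightDual.ext fun x =>
            (congrArg (g a) (BalancedTensor.zero_tmul R x)).trans (map_zero _)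
          map_add' := fun p q => RightDual.ext fun x =>
            (congrArg (g a) (BalancedTensor.add_tmul R p q x)).trans (map_add _ _ _) }
      map_zero' := by
        ext p x
        change g 0 _ = 0
        rw [map_zero]; rfl
      map_add' := fun a a' => by
        ext p x
        change g (a + a') _ = g a _ + g a' _
        rw [map_add]; rfl }
    (fun a s p => RightDual.ext fun x => by
      change g (op s • a) (BalancedTensor.tmul R p x) = g a (BalancedTensor.tmul R (s • p) x)
      rw [map_smul]; rfl)
  let gl : BalancedTensor S A P →ₗ[Rᵐᵒᵖ] RightDual R F :=
    { gb with
      map_smul' := fun r t => by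
        change gb (r • t) = r • gb t
        induction t using BalancedTensor.induction_on with
        | zero => simp
        | tmul a p =>
          exact RightDual.ext fun x => congrArg (g a) (BalancedTensor.smul_tmul R p r.unop x)
        | add x y hx hy => rw [smul_add, map_add, map_add, smul_add, hx, hy] }
  let fl : BalancedTensor S A P →ₗ[Rᵐᵒᵖ] BalancedTensor S A' P :=
    { BalancedTensor.map S f (LinearMap.id : P →ₗ[S] P) with
      map_smul' := fun r t => by
        change BalancedTensor.map S f _ (r • t) = r • BalancedTensor.map S f _ t
        induction t using BalancedTensor.induction_on with
        | zero => simp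
        | tmul a p => rfl
        | add x y hx hy => rw [smul_add, map_add, map_add, smul_add, hx, hy] }
  obtain ⟨h, hh⟩ := hF.out fl (hP A A' f hf) gl
  -- The extension `h` of `gl` is transposed back.
  let hb (a : A') : RightDual S (BalancedTensor R P F) := BalancedTensor.lift
    { toFun := fun p => (h (BalancedTensor.tmul S a p) : F →+ AddCircle (1 : ℚ))
      map_zero' := by rw [BalancedTensor.tmul_zero, map_zero]; rfl
      map_add' := fun p q => by rw [BalancedTensor.tmul_add, map_add]; rfl }
    (fun p r x => by
      change h (BalancedTensor.tmul S a (op r • p)) x = h (BalancedTensor.tmul S a p) (r • x)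
      rw [← BalancedTensor.right_smul_tmul, map_smul]; rfl)
  refine ⟨{ toFun := hb, map_add' := fun a a' => ?_, map_smul' := fun s a => ?_ }, fun a => ?_⟩
  · refine BalancedTensor.hom_ext (f := hb (a + a')) (g := hb a + hb a') fun p x => ?_
    change h (BalancedTensor.tmul S (a + a') p) x =
      h (BalancedTensor.tmul S a p) x + h (BalancedTensor.tmul S a' p) x
    rw [BalancedTensor.add_tmul, map_add]; rfl
  · refine BalancedTensor.hom_ext (f := hb (s • a)) (g := s • hb a) fun p x => ?_
    change h (BalancedTensor.tmul S (s • a) p) x = h (BalancedTensor.tmul S a (s.unop • p)) x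
    rw [← BalancedTensor.smul_tmul]; rfl
  · refine BalancedTensor.hom_ext (f := hb (f a)) (g := g a) fun p x => ?_
    exact DFunLike.congr_fun (hh (BalancedTensor.tmul S a p)) x

end ChangeRings

/-! ### Injective envelopes -/

section Envelope

variable {R : Type u} [Ring R]

/-- Maximal essential extensions inside an injective module are direct summands. -/
theorem exists_injective_essential_extension {Q : Type u} [AddCommGroup Q] [Module R Q]
    [Module.Injective R Q] (E : Submodule R Q) :
    ∃ J : Submodule R Q, E ≤ J ∧ (∀ S ≤ J, S ⊓ E = ⊥ → S = ⊥) ∧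
      ∃ r : Q →ₗ[R] J, ∀ x : J, r x = x := by
  -- `J` is a maximal essential extension of `E` inside `Q`.
  obtain ⟨J, hEJ, hJ⟩ := zorn_le_nonempty₀ {J : Submodule R Q | ∀ S ≤ J, S ⊓ E = ⊥ → S = ⊥}
    (fun c hc hchain J₀ hJ₀ => by
      refine ⟨sSup c, fun S hS hSE => ?_, fun z hz => le_sSup hz⟩
      rw [eq_bot_iff]
      intro x hx
      obtain ⟨J, hJc, hxJ⟩ := (Submodule.mem_sSup_of_directed ⟨J₀, hJ₀⟩ hchain.directedOn).1 (hS hx)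
      have h1 := hc hJc (R ∙ x) (by simpa using hxJ) (by
        rw [eq_bot_iff, ← hSE]
        exact inf_le_inf_right _ (by simpa using hx))
      simpa using h1) E (fun S hS hSE => by rwa [inf_eq_left.2 hS] at hSE)
  have hess : ∀ S ≤ J, S ⊓ E = ⊥ → S = ⊥ := hJ.prop
  -- `C` is a maximal submodule with `C ⊓ J = ⊥`, so that `J → Q ⧸ C` is an essential extension.
  obtain ⟨C, -, hC⟩ := zorn_le_nonempty₀ {C : Submodule R Q | C ⊓ J = ⊥}
    (fun c hc hchain C₀ hC₀ => by
      refine ⟨sSup c, ?_, fun z hz => le_sSup hz⟩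
      change sSup c ⊓ J = ⊥
      rw [eq_bot_iff]
      rintro x ⟨hx, hxJ⟩
      obtain ⟨C, hCc, hxC⟩ := (Submodule.mem_sSup_of_directed ⟨C₀, hC₀⟩ hchain.directedOn).1 hx
      have h1 : C ⊓ J = ⊥ := hc hCc
      rw [← h1]
      exact ⟨hxC, hxJ⟩) ⊥ (by simp)
  have hCJ : C ⊓ J = ⊥ := hC.prop
  let π : J →ₗ[R] Q ⧸ C := C.mkQ ∘ₗ J.subtype
  have hπ : Function.Injective π := by
    rw [injective_iff_map_eq_zero]
    intro x hx
    have : (x : Q) ∈ C ⊓ J := ⟨(Submodule.Quotient.mk_eq_zero C).1 hx, x.2⟩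
    rw [hCJ, Submodule.mem_bot] at this
    exact Subtype.ext this
  obtain ⟨h, hh⟩ := Module.Injective.out π hπ J.subtype
  have hess' : ∀ S : Submodule R (Q ⧸ C), S ⊓ LinearMap.range π = ⊥ → S = ⊥ := by
    intro S hS
    have h1 : S.comap C.mkQ ≤ C := by
      refine hC.le_of_ge (y := S.comap C.mkQ) ?_ ?_
      · change S.comap C.mkQ ⊓ J = ⊥
        rw [eq_bot_iff]
        rintro x ⟨hxS, hxJ⟩
        have hx : C.mkQ x ∈ S ⊓ LinearMap.range π := ⟨hxS, ⟨x, hxJ⟩, rfl⟩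
        rw [hS, Submodule.mem_bot] at hx
        rw [← hCJ]
        exact ⟨(Submodule.Quotient.mk_eq_zero C).1 hx, hxJ⟩
      · intro x hx
        have : C.mkQ x = 0 := (Submodule.Quotient.mk_eq_zero C).2 hx
        change C.mkQ x ∈ S
        rw [this]
        exact S.zero_mem
    rw [eq_bot_iff]
    intro y hy
    obtain ⟨x, rfl⟩ := C.mkQ_surjective y
    exact (Submodule.mem_bot R).2 ((Submodule.Quotient.mk_eq_zero C).2 (h1 hy))
  have hker : LinearMap.ker h = ⊥ := by
    refine hess' _ ?_
    rw [eq_bot_iff]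
    rintro _ ⟨hy, x, rfl⟩
    have h1 : (x : Q) = 0 := (hh x).symm.trans hy
    have h2 : x = 0 := Subtype.ext h1
    simp [h2]
  -- By maximality of `J`, the essential extension `h : Q ⧸ C → Q` of `J` is no larger than `J`.
  have hrange : LinearMap.range h ≤ J := by
    refine hJ.le_of_ge (y := LinearMap.range h) ?_ ?_
    · intro S hS hSE
      have h1 : S.comap h = ⊥ := by
        refine hess' _ ?_
        have h2 : S ⊓ J = ⊥ := hess _ inf_le_right (by
          rw [inf_assoc, inf_eq_right.2 hEJ, hSE])
        rw [eq_bot_iff]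
        rintro _ ⟨hy, x, rfl⟩
        have h3 : (x : Q) ∈ S ⊓ J := ⟨by rw [← J.subtype_apply, ← hh x]; exact hy, x.2⟩
        rw [h2, Submodule.mem_bot] at h3
        have h4 : x = 0 := Subtype.ext h3
        simp [h4]
      rw [eq_bot_iff]
      intro x hx
      obtain ⟨y, rfl⟩ := hS hx
      have : y ∈ S.comap h := hx
      rw [h1, Submodule.mem_bot] at this
      simp [this]
    · intro x hx
      exact ⟨π ⟨x, hx⟩, hh ⟨x, hx⟩⟩
  refine ⟨J, hEJ, hess, (h ∘ₗ C.mkQ).codRestrict J fun x => hrange ⟨_, rfl⟩, fun x => ?_⟩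
  exact Subtype.ext (hh x)

theorem Module.Injective.of_retract {E E' : Type u} [AddCommGroup E] [Module R E]
    [AddCommGroup E'] [Module R E'] (h : Module.Injective R E') (i : E →ₗ[R] E')
    (r : E' →ₗ[R] E) (hri : ∀ x, r (i x) = x) : Module.Injective R E := by
  refine ⟨fun X Y _ _ _ _ f hf g => ?_⟩
  obtain ⟨k, hk⟩ := h.out f hf (i ∘ₗ g)
  exact ⟨r ∘ₗ k, fun x => by simp [hk, hri]⟩

/-- Every module has an injective envelope. -/
theorem exists_injective_envelope (E : Type u) [AddCommGroup E] [Module R E] :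
    ∃ (J : Type u) (_ : AddCommGroup J) (_ : Module R J) (i : E →ₗ[R] J),
      Module.Injective R J ∧ Function.Injective i ∧
        ∀ S : Submodule R J, S ⊓ LinearMap.range i = ⊥ → S = ⊥ := by
  let Q := Injective.under (ModuleCat.of R E)
  let i : E →ₗ[R] Q := (Injective.ι (ModuleCat.of R E)).hom
  have hi : Function.Injective i :=
    (ModuleCat.mono_iff_injective (Injective.ι (ModuleCat.of R E))).1 inferInstance
  have hQ : Module.Injective R Q :=
    Module.injective_module_of_injective_object R Q
      (inj := inferInstanceAs (CategoryTheory.Injective (Injective.under (ModuleCat.of R E))))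
  obtain ⟨J, hEJ, hess, r, hr⟩ := exists_injective_essential_extension (LinearMap.range i)
  refine ⟨J, inferInstance, inferInstance, i.codRestrict J fun x => hEJ ⟨x, rfl⟩,
    hQ.of_retract J.subtype r hr, fun x y h => hi (congrArg Subtype.val h), fun S hS => ?_⟩
  have h1 := hess (S.map J.subtype) (Submodule.map_subtype_le J S) (by
    rw [eq_bot_iff]
    rintro _ ⟨⟨y, hy, rfl⟩, x, hx⟩
    have h2 : y ∈ S ⊓ LinearMap.range (i.codRestrict J fun x => hEJ ⟨x, rfl⟩) :=
      ⟨hy, x, Subtype.ext hx⟩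
    rw [hS, Submodule.mem_bot] at h2
    simp [h2])
  exact Submodule.map_injective_of_injective J.injective_subtype
    (h1.trans (Submodule.map_bot _).symm)

/-- If `E` is a retract of `X`, then an essential extension `J` of `E` that is injective is a
retract of any injective extension `Q` of `X`, compatibly with the retraction of `X` onto `E`. -/
theorem exists_retract_of_essential {E X J Q : Type u} [AddCommGroup E] [Module R E]
    [AddCommGroup X] [Module R X] [AddCommGroup J] [Module R J] [AddCommGroup Q] [Module R Q]
    (hJ : Module.Injective R J) (hQ : Module.Injective R Q) (ι : E →ₗ[R] J)
    (hι : Function.Injective ι) (hess : ∀ S : Submodule R J, S ⊓ LinearMap.range ι = ⊥ → S = ⊥)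
    (q : X →ₗ[R] Q) (hq : Function.Injective q) (i : E →ₗ[R] X) (r : X →ₗ[R] E)
    (hri : ∀ x, r (i x) = x) :
    ∃ (s : J →ₗ[R] Q) (p : Q →ₗ[R] J), (∀ x, p (s x) = x) ∧ (∀ x, s (ι x) = q (i x)) ∧
      ∀ x, p (q x) = ι (r x) := by
  obtain ⟨s, hs⟩ := hQ.out ι hι (q ∘ₗ i)
  obtain ⟨p, hp⟩ := hJ.out q hq (ι ∘ₗ r)
  have hps : ∀ x, p (s (ι x)) = ι x := fun x => by rw [hs]; simp [hp, hri]
  -- `p ∘ s` fixes `E` pointwise, so it is an automorphism of the envelope `J`.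
  have hinj : LinearMap.ker (p ∘ₗ s) = ⊥ := hess _ (by
    rw [eq_bot_iff]
    rintro _ ⟨hy, x, rfl⟩
    exact (Submodule.mem_bot R).2 ((hps x).symm.trans hy))
  obtain ⟨t, ht⟩ := hJ.out (p ∘ₗ s) (LinearMap.ker_eq_bot.1 hinj) LinearMap.id
  have htι : ∀ x, t (ι x) = ι x := fun x => by
    conv_lhs => rw [← hps x]
    exact ht (ι x)
  exact ⟨s, t ∘ₗ p, ht, hs, fun x => by simp [hp, htι]⟩

end Envelope

/-! ### Modules with an injective coresolution of bounded flat dimensions -/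

/-- There is an exact sequence `0 → X → Q⁰ → ⋯ → Qⁿ⁻¹` with every `Qⁱ` injective and of flat
dimension at most `c + i`. It is split into short exact sequences `0 → X → Q → Y → 0`. -/
def HasFlatBoundedCoresolution (R : Type u) [Ring R] :
    ℕ → ℤ → ∀ (X : Type u) [AddCommGroup X] [Module R X], Prop
  | 0, _, _, _, _ => True
  | n + 1, c, X, _, _ => ∃ (Q : Type u) (_ : AddCommGroup Q) (_ : Module R Q)
    (Y : Type u) (_ : AddCommGroup Y) (_ : Module R Y) (q : X →ₗ[R] Q) (p : Q →ₗ[R] Y),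
      Module.Injective R Q ∧ Function.Injective q ∧ Function.Exact q p ∧ Function.Surjective p ∧
        FlatDimLE R Q c ∧ HasFlatBoundedCoresolution R n (c + 1) Y

namespace HasFlatBoundedCoresolution

variable {R : Type u} [Ring R]

/-- The coresolution of a retract `E` of `X` may be chosen to start with an injective envelope. -/
theorem succ_of_retract {n : ℕ} {c : ℤ}
    (ih : ∀ {c : ℤ} {E X : Type u} [AddCommGroup E] [Module R E] [AddCommGroup X] [Module R X]
      (i : E →ₗ[R] X) (r : X →ₗ[R] E), (∀ x, r (i x) = x) →
        HasFlatBoundedCoresolution R n c X → HasFlatBoundedCoresolution R n c E)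
    {E X J : Type u} [AddCommGroup E] [Module R E] [AddCommGroup X] [Module R X]
    [AddCommGroup J] [Module R J] (i : E →ₗ[R] X) (r : X →ₗ[R] E) (hri : ∀ x, r (i x) = x)
    (h : HasFlatBoundedCoresolution R (n + 1) c X) (ι : E →ₗ[R] J) (hJ : Module.Injective R J)
    (hι : Function.Injective ι) (hess : ∀ S : Submodule R J, S ⊓ LinearMap.range ι = ⊥ → S = ⊥) :
    FlatDimLE R J c ∧ HasFlatBoundedCoresolution R n (c + 1) (J ⧸ LinearMap.range ι) := by
  obtain ⟨Q, _, _, Y, _, _, q, p, hQ, hq, hqp, hp, hfd, hY⟩ := h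
  obtain ⟨s, t, hts, hsι, htq⟩ := exists_retract_of_essential hJ hQ ι hι hess q hq i r hri
  refine ⟨hfd.of_retract s t (LinearMap.ext hts), ?_⟩
  let s' : (J ⧸ LinearMap.range ι) →ₗ[R] Y := (LinearMap.range ι).liftQ (p ∘ₗ s) (by
    rintro _ ⟨x, rfl⟩
    change p (s (ι x)) = 0
    rw [hsι, hqp.apply_apply_eq_zero])
  have ht' : LinearMap.ker p ≤ LinearMap.ker ((LinearMap.range ι).mkQ ∘ₗ t) := by
    intro y hy
    obtain ⟨x, rfl⟩ := (hqp y).1 hy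
    change (LinearMap.range ι).mkQ (t (q x)) = 0
    rw [htq]
    exact (Submodule.Quotient.mk_eq_zero _).2 ⟨_, rfl⟩
  let t' : Y →ₗ[R] J ⧸ LinearMap.range ι :=
    (LinearMap.ker p).liftQ ((LinearMap.range ι).mkQ ∘ₗ t) ht' ∘ₗ
      (p.quotKerEquivOfSurjective hp).symm.toLinearMap
  have ht'p : ∀ y, t' (p y) = (LinearMap.range ι).mkQ (t y) := fun y => by
    have : (p.quotKerEquivOfSurjective hp).symm (p y) = Submodule.Quotient.mk y := by
      rw [LinearEquiv.symm_apply_eq]; rfl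
    change (LinearMap.ker p).liftQ _ ht' ((p.quotKerEquivOfSurjective hp).symm (p y)) = _
    rw [this]; rfl
  refine ih s' t' (fun x => ?_) hY
  obtain ⟨x, rfl⟩ := (LinearMap.range ι).mkQ_surjective x
  change t' (p (s x)) = _
  rw [ht'p, hts]

theorem of_retract (n : ℕ) : ∀ {c : ℤ} {E X : Type u} [AddCommGroup E] [Module R E]
    [AddCommGroup X] [Module R X] (i : E →ₗ[R] X) (r : X →ₗ[R] E), (∀ x, r (i x) = x) →
      HasFlatBoundedCoresolution R n c X → HasFlatBoundedCoresolution R n c E := by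
  induction n with
  | zero => intros; trivial
  | succ n ih =>
    intro c E X _ _ _ _ i r hri h
    obtain ⟨J, _, _, ι, hJ, hι, hess⟩ := exists_injective_envelope (R := R) E
    obtain ⟨h1, h2⟩ := succ_of_retract ih i r hri h ι hJ hι hess
    refine ⟨J, _, _, J ⧸ LinearMap.range ι, _, _, ι, (LinearMap.range ι).mkQ, hJ, hι, ?_,
      (LinearMap.range ι).mkQ_surjective, h1, h2⟩
    rw [LinearMap.exact_iff, Submodule.ker_mkQ]

/-- The injective envelope and the cosyzygy of a module inherit the bounds. -/
theorem of_essential {n : ℕ} {c : ℤ} {E J : Type u} [AddCommGroup E] [Module R E]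
    [AddCommGroup J] [Module R J] (h : HasFlatBoundedCoresolution R (n + 1) c E)
    (ι : E →ₗ[R] J) (hJ : Module.Injective R J) (hι : Function.Injective ι)
    (hess : ∀ S : Submodule R J, S ⊓ LinearMap.range ι = ⊥ → S = ⊥) :
    FlatDimLE R J c ∧ HasFlatBoundedCoresolution R n (c + 1) (J ⧸ LinearMap.range ι) :=
  succ_of_retract (of_retract n) LinearMap.id LinearMap.id (fun _ => rfl) h ι hJ hι hess

theorem pi_const (k : ℕ) (n : ℕ) : ∀ {c : ℤ} {X : Type u} [AddCommGroup X] [Module R X],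
    HasFlatBoundedCoresolution R n c X → HasFlatBoundedCoresolution R n c (Fin k → X) := by
  induction n with
  | zero => intros; trivial
  | succ n ih =>
    rintro c X _ _ ⟨Q, _, _, Y, _, _, q, p, hQ, hq, hqp, hp, hfd, hY⟩
    exact ⟨Fin k → Q, _, _, Fin k → Y, _, _, q.compLeft (Fin k), p.compLeft (Fin k),
      inferInstance, hq.comp_left, exact_compLeft hqp, hp.comp_left,
      HasFlatResolution.pi_const k _ _ hfd, ih hY⟩

/-- The property passes along a functor that preserves short exact sequences, injectives and
bounds on the flat dimension. -/
theorem map {S : Type u} [Ring S] (G : ModuleCat.{u} R ⥤ ModuleCat.{u} S)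
    [Limits.PreservesFiniteLimits G] [Limits.PreservesFiniteColimits G] [G.PreservesZeroMorphisms]
    [G.PreservesInjectiveObjects]
    (hflat : ∀ (d : ℤ) (E : ModuleCat.{u} R), FlatDimLE R E d → FlatDimLE S (G.obj E) d)
    (n : ℕ) : ∀ {c : ℤ} {X : Type u} [AddCommGroup X] [Module R X],
      HasFlatBoundedCoresolution R n c X →
        HasFlatBoundedCoresolution S n c (G.obj (ModuleCat.of R X)) := by
  induction n with
  | zero => intros; trivial
  | succ n ih =>
    rintro c X _ _ ⟨Q, _, _, Y, _, _, q, p, hQ, hq, hqp, hp, hfd, hY⟩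
    have hS : (ShortComplex.mk (ModuleCat.ofHom q) (ModuleCat.ofHom p)
        (by ext x; exact hqp.apply_apply_eq_zero x)).ShortExact :=
      ModuleCat.shortComplex_shortExact _ hqp hq hp
    have hGS := hS.map_of_exact G
    have hQ' := (Module.injective_iff_injective_object R Q).1 hQ
    have hGQ : CategoryTheory.Injective (G.obj (ModuleCat.of R Q)) :=
      G.injective_obj_of_injective hQ'
    exact ⟨G.obj (ModuleCat.of R Q), _, _, G.obj (ModuleCat.of R Y), _, _,
      (G.map (ModuleCat.ofHom q)).hom, (G.map (ModuleCat.ofHom p)).hom,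
      Module.injective_module_of_injective_object _ _ (inj := hGQ), hGS.moduleCat_injective_f,
      (ShortComplex.ShortExact.moduleCat_exact_iff_function_exact _).1 hGS.exact,
      hGS.moduleCat_surjective_g, hflat c _ hfd, ih hY⟩

end HasFlatBoundedCoresolution

/-! ### Minimal injective resolutions -/

section Resolution

variable {R : Type u} [Ring R]

/-- The kernels of the differentials of an injective resolution inherit coresolutions from it. -/
theorem CategoryTheory.InjectiveResolution.hasFlatBoundedCoresolution_ker {E : ModuleCat.{u} R}
    (I : InjectiveResolution E) (k : ℤ) (n : ℕ) : ∀ i : ℕ,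
      (∀ j, i ≤ j → j < i + n → FlatDimLE R (I.cocomplex.X j) (k + j)) →
        HasFlatBoundedCoresolution R n (k + i)
          (LinearMap.ker (I.cocomplex.d i (i + 1)).hom) := by
  induction n with
  | zero => intros; trivial
  | succ n ih =>
    intro i h
    have hex := (ShortComplex.ShortExact.moduleCat_exact_iff_function_exact _).1 (I.exact_succ i)
    have hinj : Module.Injective R (I.cocomplex.X i) :=
      Module.injective_module_of_injective_object _ _ (inj := I.injective i)
    refine ⟨I.cocomplex.X i, _, _, LinearMap.ker (I.cocomplex.d (i + 1) (i + 1 + 1)).hom, _, _,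
      (LinearMap.ker (I.cocomplex.d i (i + 1)).hom).subtype,
      (I.cocomplex.d i (i + 1)).hom.codRestrict _ fun x => hex.apply_apply_eq_zero x,
      hinj, Submodule.injective_subtype _, fun x => ?_, fun y => ?_, h i le_rfl (by omega), ?_⟩
    · constructor
      · intro hx
        exact ⟨⟨x, congrArg Subtype.val hx⟩, rfl⟩
      · rintro ⟨x, rfl⟩
        exact Subtype.ext x.2
    · obtain ⟨x, hx⟩ := (hex y.1).1 y.2
      exact ⟨x, Subtype.ext hx⟩
    · have := ih (i + 1) fun j hj hj' => h j (by omega) (by omega)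
      rwa [Nat.cast_add, Nat.cast_one, ← add_assoc] at this

/-- `E` is isomorphic to the kernel of the first differential of its resolution. -/
theorem CategoryTheory.InjectiveResolution.hasFlatBoundedCoresolution {E : ModuleCat.{u} R}
    (I : InjectiveResolution E) (k : ℤ) (n : ℕ)
    (h : ∀ j, j < n → FlatDimLE R (I.cocomplex.X j) (k + j)) :
    HasFlatBoundedCoresolution R n k E := by
  have h0 := I.hasFlatBoundedCoresolution_ker k n 0 fun j _ hj => h j (by omega)
  rw [Nat.cast_zero, add_zero] at h0
  have hex := (ShortComplex.ShortExact.moduleCat_exact_iff_function_exact _).1 I.exact₀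
  have hinj : Function.Injective (I.ι.f 0).hom :=
    (ModuleCat.mono_iff_injective (I.ι.f 0)).1 inferInstance
  let e : E ≃ₗ[R] LinearMap.ker (I.cocomplex.d 0 1).hom :=
    (HomologicalComplex.singleObjXSelf (ComplexShape.up ℕ) 0 E).symm.toLinearEquiv ≪≫ₗ
      LinearEquiv.ofInjective (I.ι.f 0).hom hinj ≪≫ₗ
      LinearEquiv.ofEq _ _ (LinearMap.exact_iff.1 hex).symm
  exact .of_retract n e.toLinearMap e.symm.toLinearMap e.symm_apply_apply h0

theorem exists_hom_injective_envelope (E : ModuleCat.{u} R) :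
    ∃ (J : ModuleCat.{u} R) (ι : E ⟶ J), Module.Injective R J ∧ Function.Injective ι.hom ∧
      ∀ S : Submodule R J, S ⊓ LinearMap.range ι.hom = ⊥ → S = ⊥ := by
  obtain ⟨J, _, _, i, hJ, hi, hess⟩ := exists_injective_envelope (R := R) E
  exact ⟨ModuleCat.of R J, ModuleCat.ofHom i, hJ, hi, hess⟩

/-- A chosen injective envelope of `E`. -/
noncomputable def injectiveEnvelope (E : ModuleCat.{u} R) : ModuleCat.{u} R :=
  (exists_hom_injective_envelope E).choose

/-- The embedding of `E` into its chosen injective envelope. -/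
noncomputable def injectiveEnvelopeι (E : ModuleCat.{u} R) : E ⟶ injectiveEnvelope E :=
  (exists_hom_injective_envelope E).choose_spec.choose

instance (E : ModuleCat.{u} R) : Module.Injective R (injectiveEnvelope E) :=
  (exists_hom_injective_envelope E).choose_spec.choose_spec.1

theorem injectiveEnvelopeι_injective (E : ModuleCat.{u} R) :
    Function.Injective (injectiveEnvelopeι E).hom :=
  (exists_hom_injective_envelope E).choose_spec.choose_spec.2.1

theorem eq_bot_of_inf_range_injectiveEnvelopeι (E : ModuleCat.{u} R)
    (S : Submodule R (injectiveEnvelope E))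
    (hS : S ⊓ LinearMap.range (injectiveEnvelopeι E).hom = ⊥) : S = ⊥ :=
  (exists_hom_injective_envelope E).choose_spec.choose_spec.2.2 S hS

/-- The `i`-th cosyzygy of `E`: the `i`-fold iteration of `E ↦ J(E) ⧸ E`, with `J(E)` the injective
envelope. -/
noncomputable def cosyzygy (E : ModuleCat.{u} R) : ℕ → ModuleCat.{u} R
  | 0 => E
  | i + 1 => ModuleCat.of R (injectiveEnvelope (cosyzygy E i) ⧸
      LinearMap.range (injectiveEnvelopeι (cosyzygy E i)).hom)

/-- The projection of the injective envelope of a cosyzygy onto the next cosyzygy. -/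
noncomputable def cosyzygyπ (E : ModuleCat.{u} R) (i : ℕ) :
    injectiveEnvelope (cosyzygy E i) ⟶ cosyzygy E (i + 1) :=
  ModuleCat.ofHom (LinearMap.range (injectiveEnvelopeι (cosyzygy E i)).hom).mkQ

theorem ker_cosyzygyπ (E : ModuleCat.{u} R) (i : ℕ) : LinearMap.ker (cosyzygyπ E i).hom =
    LinearMap.range (injectiveEnvelopeι (cosyzygy E i)).hom :=
  Submodule.ker_mkQ _

theorem range_cosyzygyπ (E : ModuleCat.{u} R) (i : ℕ) : LinearMap.range (cosyzygyπ E i).hom = ⊤ :=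
  Submodule.range_mkQ _

/-- The differential `J(Eⁱ) → J(Eⁱ) ⧸ Eⁱ = Eⁱ⁺¹ → J(Eⁱ⁺¹)` between the injective envelopes of
successive cosyzygies. -/
noncomputable def minimalD (E : ModuleCat.{u} R) (i : ℕ) :
    injectiveEnvelope (cosyzygy E i) ⟶ injectiveEnvelope (cosyzygy E (i + 1)) :=
  cosyzygyπ E i ≫ injectiveEnvelopeι (cosyzygy E (i + 1))

theorem ker_minimalD (E : ModuleCat.{u} R) (i : ℕ) : LinearMap.ker (minimalD E i).hom =
    LinearMap.range (injectiveEnvelopeι (cosyzygy E i)).hom := by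
  rw [minimalD, ModuleCat.hom_comp, LinearMap.ker_comp_of_ker_eq_bot _
    (LinearMap.ker_eq_bot.2 (injectiveEnvelopeι_injective _)), ker_cosyzygyπ]

theorem range_minimalD (E : ModuleCat.{u} R) (i : ℕ) : LinearMap.range (minimalD E i).hom =
    LinearMap.range (injectiveEnvelopeι (cosyzygy E (i + 1))).hom := by
  rw [minimalD, ModuleCat.hom_comp, LinearMap.range_comp_of_range_eq_top _ (range_cosyzygyπ E i)]

theorem minimalD_exact (E : ModuleCat.{u} R) (i : ℕ) :
    Function.Exact (minimalD E i) (minimalD E (i + 1)) :=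
  LinearMap.exact_iff.2 ((ker_minimalD E (i + 1)).trans (range_minimalD E i).symm)

theorem injectiveEnvelopeι_minimalD_exact (E : ModuleCat.{u} R) :
    Function.Exact (injectiveEnvelopeι E) (minimalD E 0) :=
  LinearMap.exact_iff.2 (ker_minimalD E 0)

theorem injectiveEnvelopeι_comp_minimalD (E : ModuleCat.{u} R) :
    injectiveEnvelopeι E ≫ minimalD E 0 = 0 := by
  ext x
  exact (injectiveEnvelopeι_minimalD_exact E).apply_apply_eq_zero x

/-- The cochain complex of injective envelopes of the cosyzygies. -/
noncomputable def minimalCocomplex (E : ModuleCat.{u} R) : CochainComplex (ModuleCat.{u} R) ℕ :=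
  CochainComplex.of (fun i => injectiveEnvelope (cosyzygy E i)) (minimalD E) fun i => by
    ext x
    exact (minimalD_exact E i).apply_apply_eq_zero x

theorem minimalCocomplex_d (E : ModuleCat.{u} R) (i : ℕ) :
    (minimalCocomplex E).d i (i + 1) = minimalD E i :=
  CochainComplex.of_d (fun i => injectiveEnvelope (cosyzygy E i)) (minimalD E) i

theorem minimalCocomplex_exactAt_succ (E : ModuleCat.{u} R) (i : ℕ) :
    (minimalCocomplex E).ExactAt (i + 1) := by
  rw [HomologicalComplex.exactAt_iff' _ i (i + 1) (i + 1 + 1) (by simp) (by simp)]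
  refine ModuleCat.shortComplex_exact _ ?_
  change Function.Exact ((minimalCocomplex E).d i (i + 1))
    ((minimalCocomplex E).d (i + 1) (i + 1 + 1))
  rw [minimalCocomplex_d, minimalCocomplex_d]
  exact minimalD_exact E i

/-- The resolution by the injective envelopes of the cosyzygies. -/
noncomputable def minimalResolution (E : ModuleCat.{u} R) : InjectiveResolution E where
  cocomplex := minimalCocomplex E
  injective i := Module.injective_object_of_injective_module R (injectiveEnvelope (cosyzygy E i))
  ι := (CochainComplex.fromSingle₀Equiv _ _).symm ⟨injectiveEnvelopeι E,
    (congrArg (injectiveEnvelopeι E ≫ ·) (minimalCocomplex_d E 0)).trans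
      (injectiveEnvelopeι_comp_minimalD E)⟩
  quasiIso := ⟨fun n => by
    cases n
    · rw [CochainComplex.quasiIsoAt₀_iff, ShortComplex.quasiIso_iff_of_zeros]
      · refine (ShortComplex.exact_and_mono_f_iff_of_iso (S₁ := ShortComplex.mk
          (injectiveEnvelopeι E) (minimalD E 0) (injectiveEnvelopeι_comp_minimalD E)) ?_).1
          ⟨ModuleCat.shortComplex_exact _ (injectiveEnvelopeι_minimalD_exact E),
            (ModuleCat.mono_iff_injective _).2 (injectiveEnvelopeι_injective E)⟩
        refine ShortComplex.isoMk (Iso.refl _) (Iso.refl _) (Iso.refl _) ?_ ?_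
        · exact (Category.id_comp _).trans
            ((CochainComplex.fromSingle₀Equiv_symm_apply_f_zero _ _).trans
              (Category.comp_id _).symm)
        · exact (Category.id_comp _).trans
            ((minimalCocomplex_d E 0).trans (Category.comp_id _).symm)
      all_goals rfl
    · rw [quasiIsoAt_iff_exactAt]
      · apply minimalCocomplex_exactAt_succ
      · apply CochainComplex.exactAt_succ_single_obj⟩

theorem isMinimalResolution_minimalResolution (E : ModuleCat.{u} R) :
    IsMinimalResolution (minimalResolution E) := by
  intro i S hS
  have hker : LinearMap.ker ((minimalResolution E).cocomplex.d i (i + 1)).hom =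
      LinearMap.range (injectiveEnvelopeι (cosyzygy E i)).hom :=
    (congrArg (fun f => LinearMap.ker (ModuleCat.Hom.hom f)) (minimalCocomplex_d E i)).trans
      (ker_minimalD E i)
  exact eq_bot_of_inf_range_injectiveEnvelopeι _ S (by rwa [hker] at hS)

theorem HasFlatBoundedCoresolution.cosyzygy (E : ModuleCat.{u} R) (k : ℤ) (n : ℕ)
    (h : HasFlatBoundedCoresolution R n k E) (i : ℕ) : ∀ m : ℕ, m + i = n →
      HasFlatBoundedCoresolution R m (k + i) (cosyzygy E i) := by
  induction i with
  | zero =>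
    rintro m rfl
    rw [Nat.cast_zero, add_zero]
    exact h
  | succ i ih =>
    intro m hm
    have h1 := ((ih (m + 1) (by omega)).of_essential (injectiveEnvelopeι _).hom inferInstance
      (injectiveEnvelopeι_injective _) (eq_bot_of_inf_range_injectiveEnvelopeι _)).2
    rw [Nat.cast_add, Nat.cast_one, ← add_assoc]
    exact h1

/-- A bounded coresolution need not be minimal, so this frees the condition `G_n(k)` from
minimality: the minimal resolution is a direct summand of any other. -/
theorem auslanderTypeCondition_iff (n k : ℤ) :
    AuslanderTypeCondition n k R ↔ HasFlatBoundedCoresolution R n.toNat k R := by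
  constructor
  · rintro ⟨I, -, h⟩
    exact I.hasFlatBoundedCoresolution k n.toNat fun j hj => h j (by omega)
  · intro h
    refine ⟨minimalResolution (ModuleCat.of R R), isMinimalResolution_minimalResolution _,
      fun i hi => ?_⟩
    obtain ⟨m, hm⟩ : ∃ m, m + 1 + i = n.toNat := ⟨n.toNat - 1 - i, by omega⟩
    exact ((HasFlatBoundedCoresolution.cosyzygy (ModuleCat.of R R) k _ h i (m + 1)
      hm).of_essential (injectiveEnvelopeι _).hom inferInstance
      (injectiveEnvelopeι_injective _) (eq_bot_of_inf_range_injectiveEnvelopeι _)).1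

end Resolution

/-! ### Transfer along a symmetric separable equivalence -/

section Transfer

variable {S R P : Type u} [Ring S] [Ring R] [AddCommGroup P] [Module S P] [Module Rᵐᵒᵖ P]
  [SMulCommClass S Rᵐᵒᵖ P]

/-- An exact functor `P ⊗_R -` with `P` flat over `S` preserves flat resolutions. -/
theorem HasFlatResolution.functor_obj
    [Limits.PreservesFiniteLimits (BalancedTensor.functor S R P)]
    [Limits.PreservesFiniteColimits (BalancedTensor.functor S R P)]
    [(BalancedTensor.functor S R P).PreservesZeroMorphisms]
    (hP : IsFlatModule S P) (m : ℕ) : ∀ (E : Type u) [AddCommGroup E] [Module R E],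
      HasFlatResolution R m E → HasFlatResolution S m (BalancedTensor R P E) := by
  induction m with
  | zero =>
    intro E _ _ h
    have : Subsingleton E := h
    refine ⟨fun x y => ?_⟩
    have h0 : ∀ t : BalancedTensor R P E, t = 0 := fun t => by
      induction t using BalancedTensor.induction_on with
      | zero => rfl
      | tmul a b => rw [Subsingleton.elim b 0, BalancedTensor.tmul_zero]
      | add x y hx hy => rw [hx, hy, add_zero]
    rw [h0 x, h0 y]
  | succ m ih =>
    rintro E _ _ ⟨F, _, _, f, hF, hf, hK⟩
    have hS := (LinearMap.shortExact_shortComplexKer hf).map_of_exact (BalancedTensor.functor S R P)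
    exact .of_exact (i := BalancedTensor.lTensor R S (LinearMap.ker f).subtype)
      (p := BalancedTensor.lTensor R S f) hS.moduleCat_injective_f
      ((ShortComplex.ShortExact.moduleCat_exact_iff_function_exact _).1 hS.exact)
      hS.moduleCat_surjective_g (hP.balancedTensor hF) (ih _ hK)

end Transfer

theorem IsSymmSepEquiv.symm {Λ Γ M N : Type u} [Ring Λ] [Ring Γ]
    [AddCommGroup M] [Module Λ M] [Module Γᵐᵒᵖ M] [SMulCommClass Λ Γᵐᵒᵖ M]
    [AddCommGroup N] [Module Γ N] [Module Λᵐᵒᵖ N] [SMulCommClass Γ Λᵐᵒᵖ N]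
    (h : IsSymmSepEquiv Λ Γ M N) : IsSymmSepEquiv Γ Λ N M where
  finite_left_M := h.finite_left_N
  projective_left_M := h.projective_left_N
  finite_right_M := h.finite_right_N
  projective_right_M := h.projective_right_N
  finite_left_N := h.finite_left_M
  projective_left_N := h.projective_left_M
  finite_right_N := h.finite_right_M
  projective_right_N := h.projective_right_M
  exists_iso_left := h.exists_iso_right
  exists_iso_right := h.exists_iso_left
  adj_MN := h.adj_NM
  adj_NM := h.adj_MN

/-- `Λ` has a bounded coresolution, hence so does the summand `M` of some `Λᵐ`, hence so does
`N ⊗ M`, hence so does its summand `Γ`. -/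
theorem IsSymmSepEquiv.hasFlatBoundedCoresolution {Λ Γ M N : Type u} [Ring Λ] [Ring Γ]
    [AddCommGroup M] [Module Λ M] [Module Γᵐᵒᵖ M] [SMulCommClass Λ Γᵐᵒᵖ M]
    [AddCommGroup N] [Module Γ N] [Module Λᵐᵒᵖ N] [SMulCommClass Γ Λᵐᵒᵖ N]
    (h : IsSymmSepEquiv Λ Γ M N) {n : ℕ} {k : ℤ} (hΛ : HasFlatBoundedCoresolution Λ n k Λ) :
    HasFlatBoundedCoresolution Γ n k Γ := by
  have := h.finite_left_M
  have := h.projective_left_M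
  have := h.projective_left_N
  obtain ⟨adj₁⟩ := h.adj_MN
  obtain ⟨adj₂⟩ := h.adj_NM
  have := adj₁.rightAdjoint_preservesLimits
  have := adj₁.leftAdjoint_preservesColimits
  have := adj₂.rightAdjoint_preservesLimits
  have := adj₂.leftAdjoint_preservesColimits
  have : (BalancedTensor.functor Γ Λ N).PreservesZeroMorphisms :=
    have := adj₂.isLeftAdjoint
    Functor.preservesZeroMorphisms_of_isLeftAdjoint _
  -- `N ⊗ -` is right adjoint to the exact functor `M ⊗ -`.
  have : (BalancedTensor.functor Γ Λ N).PreservesInjectiveObjects :=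
    Functor.preservesInjectiveObjects_of_adjunction_of_preservesMonomorphisms adj₁
  obtain ⟨m, f, g, -, -, hfg⟩ := Module.Finite.exists_comp_eq_id_of_projective Λ M
  have hM : HasFlatBoundedCoresolution Λ n k M :=
    .of_retract n g f (LinearMap.congr_fun hfg) (hΛ.pi_const m n)
  have hNM := HasFlatBoundedCoresolution.map (BalancedTensor.functor Γ Λ N)
    (fun d E hE => HasFlatResolution.functor_obj .of_projective _ E hE) n hM
  obtain ⟨Y, _, _, _, _, e, he, -⟩ := h.exists_iso_right
  let e' : BalancedTensor Λ N M ≃ₗ[Γ] Γ × Y := { e with map_smul' := he }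
  exact .of_retract n (e'.symm.toLinearMap ∘ₗ LinearMap.inl Γ Γ Y)
    (LinearMap.fst Γ Γ Y ∘ₗ e'.toLinearMap) (fun x => by simp) hNM

theorem theorem4p5 (Λ Γ : Type u) [Ring Λ] [Ring Γ]
    [IsNoetherianRing Λ] [IsNoetherianRing Λᵐᵒᵖ] [IsNoetherianRing Γ] [IsNoetherianRing Γᵐᵒᵖ]
    (h : SymmSepEquivalent Λ Γ) (n k : ℤ) :
    AuslanderTypeCondition n k Λ ↔ AuslanderTypeCondition n k Γ := by
  obtain ⟨M, _, _, _, _, N, _, _, _, _, h⟩ := h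
  rw [auslanderTypeCondition_iff, auslanderTypeCondition_iff]
  exact ⟨h.hasFlatBoundedCoresolution, h.symm.hasFlatBoundedCoresolution⟩
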